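/- All strings are binary, $\ell(x)$ is the length of $x$, $\epsilon$ is the empty string, and $x \sqsubseteq y$ means that $x$ is a prefix of $y$ ($x \sqsubset y$: a proper prefix). A *monotone machine* is a recursively enumerable (possibly finite) set $L$ of pairs $(p,y)$ of finite strings such that whenever $(p,y),(q,x)\in L$ and $p\sqsubseteq q$, the strings $x$ and $y$ are comparable: $y\sqsubseteq x$ or $x\sqsubseteq y$. Write $y\in L(p)$ if there is $(p,x)\in L$ with $y\sqsubseteq x$ and there is no $(q,z)\in L$ with $q\sqsubset p$ and $y\sqsubseteq z$, and let $$\mathbf M_L(y)=\sum_{p\,:\,y\in L(p)}2^{-\ell(p)} .$$ A *universal monotone machine* is a set of the form $U=\{(i'p,y) : i\in\mathbb N,\ (p,y)\in L^i\}$, where $L^0,L^1,L^2,\dots$ is a recursive enumeration (repetitions allowed) of all monotone machines and $i\mapsto i'$ is a computable prefix coding of the natural numbers by finite strings (no $i'$ is a prefix of $j'$ for $j \ne i$). Let $U$ be any universal monotone machine, let $\mathbf M=\mathbf M_U$ (the Solomonoff semimeasure) and $\mathbf M(b\mid x)=\mathbf M(xb)/\mathbf M(x)$ for $b\in\{0,1\}$.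 Then there is an infinite binary sequence $\omega$ such that $0<\mathbf M(\omega_{<n})\le 1$ for all $n$ (so that the conditional values below are well defined) and $$\liminf_{n\to\infty}\bigl[\mathbf M(0\mid\omega_{<n})+\mathbf M(1\mid\omega_{<n})\bigr]=0 ,$$ where $\omega_{<n}$ is the string of the bits of $\omega$ before the $n$-th. -/

import Mathlib

open Filter
open scoped ENNReal

namespace AIT

/-- Finite binary strings; `false` is the bit 0 and `true` is the bit 1. -/
abbrev Str : Type := List Bool

/-- A (Turing) machine: a recursively enumerable, possibly finite, set of pairs
(program, output) of finite binary strings. -/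
def IsMachine (L : Set (Str × Str)) : Prop :=
  REPred fun a : Str × Str => a ∈ L

/-- A monotone machine: whenever a program `p` is a prefix of a program `q`, every output `y`
of `p` and every output `x` of `q` are comparable, that is, the shorter one is a prefix of the
longer one. -/
def IsMonotoneMachine (L : Set (Str × Str)) : Prop :=
  IsMachine L ∧
    ∀ p y q x : Str, (p, y) ∈ L → (q, x) ∈ L → p <+: q → (y <+: x ∨ x <+: y)

/-- `Outputs L p y` is the relation `y ∈ L(p)` for a monotone machine `L`: the program `p`
produces an extension of `y`, and no proper prefix of `p` does. -/
def Outputs (L : Set (Str × Str)) (p y : Str) : Prop :=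
  (∃ x, (p, x) ∈ L ∧ y <+: x) ∧
    ¬ ∃ q z, (q, z) ∈ L ∧ (q <+: p ∧ q ≠ p) ∧ y <+: z

/-- `M_L(y) = ∑_{p : y ∈ L(p)} 2^{-ℓ(p)}`. -/
noncomputable def semimeasure (L : Set (Str × Str)) (y : Str) : ℝ≥0∞ :=
  ∑' p : {p : Str // Outputs L p y}, (2 : ℝ≥0∞)⁻¹ ^ p.1.length

/-- The conditional `M_L(b | x) = M_L(xb) / M_L(x)`. -/
noncomputable def cond (L : Set (Str × Str)) (b : Bool) (x : Str) : ℝ≥0∞ :=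
  semimeasure L (x ++ [b]) / semimeasure L x

/-- `L 0, L 1, L 2, …` is a recursive enumeration, possibly with repetitions, of all monotone
machines. -/
def IsEnumerationOfMonotoneMachines (L : ℕ → Set (Str × Str)) : Prop :=
  (REPred fun a : ℕ × (Str × Str) => a.2 ∈ L a.1) ∧
    (∀ i, IsMonotoneMachine (L i)) ∧
    ∀ S, IsMonotoneMachine S → ∃ i, L i = S

/-- A prefix coding `i ↦ i'` of the natural numbers: it is computable, and no code word is a
prefix of the code word of another number. -/
def IsPrefixCoding (c : ℕ → Str) : Prop :=
  Computable c ∧ ∀ i j, c i <+: c j → i = j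

/-- A universal monotone machine: the set of the pairs `(i'p, y)` with `(p, y) ∈ L i`, for a
recursive enumeration `L` of all monotone machines and a prefix coding `i ↦ i'`. -/
def IsUniversalMonotoneMachine (U : Set (Str × Str)) : Prop :=
  ∃ (L : ℕ → Set (Str × Str)) (c : ℕ → Str),
    IsEnumerationOfMonotoneMachines L ∧ IsPrefixCoding c ∧
      U = {a | ∃ i p y, a = (c i ++ p, y) ∧ (p, y) ∈ L i}

/-- The string of the first `n` bits of an infinite binary sequence. -/
def initial (ω : ℕ → Bool) (n : ℕ) : Str :=
  (List.range n).map ω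

end AIT

/-!
The universal semimeasure `M(y)` is the probability that fair coin tosses, read as a program,
make the universal machine `U` produce an extension of `y` (`semimeasure_eq_coin`). For a monotone
machine the events that belong to incomparable strings are disjoint (`disjoint_producing`), and the
probability can be approximated from below, so that `M(y) > 4⁻ʲ` is a recursively enumerable
condition on `y` and `j` (`rePred_inv_four_pow_lt_semimeasure`).

It suffices to find, beyond every string `x` and for every `ε > 0`, an extension `y` of `x` with
`M(y0) + M(y1) ≤ ε M(y)`: iterating this yields a chain of strings whose limit is the sequence `ω`.
Such a `y` comes from a machine that evades `U`. On the program `0ʲ1` it outputs `x` and then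
extends its output `y` bit by bit: it waits until `M(y0) > 4⁻ʲ` or `M(y1) > 4⁻ʲ` becomes apparent,
and moves to the other child of `y`. The children left behind are pairwise incomparable and each
carries more than `4⁻ʲ` of a total of at most `1`, so the machine waits forever from some point
on (`exists_not_lt_semimeasure`). At the string `y` where it gets stuck, `M(y0) + M(y1) ≤ 2 · 4⁻ʲ`.
But `U` simulates the evading machine at the cost of `d` bits, where `d` does not depend on `j`, so
`M(y) ≥ 2⁻⁽ᵈ⁺ʲ⁺¹⁾`. The quotient tends to `0` as `j` grows (`exists_extension_cond_le`). That the
program fixes the threshold in advance makes an appeal to the recursion theorem unnecessary.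
-/

namespace AIT

/-! ### Closure properties of recursively enumerable predicates -/

section REPred

open Encodable

variable {α β : Type*} [Primcodable α] [Primcodable β]

theorem rePred_comp {P : β → Prop} (hP : REPred P) {f : α → β} (hf : Computable f) :
    REPred fun a => P (f a) :=
  Partrec.comp hP hf

theorem rePred_and {P Q : α → Prop} (hP : REPred P) (hQ : REPred Q) :
    REPred fun a => P a ∧ Q a :=
  (Partrec.bind hP (hQ.comp Computable.fst).to₂).dom_re.of_eq fun a => by
    simp [Part.assert, Part.bind_dom]

theorem rePred_eq [DecidableEq β] {f g : α → β} (hf : Computable f) (hg : Computable g) :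
    REPred fun a => f a = g a :=
  ComputablePred.to_re <| ComputablePred.computable_iff.2
    ⟨fun a => decide (f a = g a), (Primrec.eq (α := β)).decide.to_comp.comp hf hg, by simp⟩

/-- An r.e. predicate is the increasing union of uniformly primitive recursive stages. -/
theorem exists_stages {P : α → Prop} (hP : REPred P) :
    ∃ T : ℕ → α → Prop, PrimrecRel T ∧ (∀ k l a, k ≤ l → T k a → T l a) ∧
      ∀ a, P a ↔ ∃ k, T k a := by
  obtain ⟨c, hc⟩ := Nat.Partrec.Code.exists_code.1 hP
  refine ⟨fun k a => (c.evaln k (encode a)).isSome = true, ?_, ?_, ?_⟩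
  · have h : Primrec fun x : ℕ × α => c.evaln x.1 (encode x.2) :=
      Nat.Partrec.Code.primrec_evaln.comp
        ((Primrec.fst.pair (Primrec.const c)).pair (Primrec.encode.comp Primrec.snd))
    exact PrimrecPred.of_eq ⟨inferInstance, (Primrec.option_isSome.comp h).of_eq fun _ => by simp⟩
      fun _ => Iff.rfl
  · intro k l a hkl h
    obtain ⟨x, hx⟩ := Option.isSome_iff_exists.1 h
    exact Option.isSome_iff_exists.2 ⟨x, Nat.Partrec.Code.evaln_mono hkl hx⟩
  · intro a
    have h : P a ↔ ∃ x, x ∈ c.eval (encode a) := by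
      rw [hc]
      simp [Part.assert]
    simp only [h, Nat.Partrec.Code.evaln_complete, Option.isSome_iff_exists, Option.mem_def]
    exact exists_comm

theorem rePred_exists_of_primrecRel {R : α → β → Prop} (hR : PrimrecRel R) :
    REPred fun a => ∃ b, R a b := by
  classical
  obtain ⟨_, hR⟩ := hR
  have h : Primrec₂ fun (a : α) (n : ℕ) =>
      (decode (α := β) n).bind fun b => if R a b then some () else none := by
    refine Primrec.option_bind (Primrec.decode.comp Primrec.snd) ?_
    refine Primrec.ite ⟨fun x => Classical.dec _, ?_⟩ (Primrec.const _) (Primrec.const _)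
    exact (hR.comp ((Primrec.fst.comp Primrec.fst).pair Primrec.snd)).of_eq fun x => by simp
  refine (Partrec.rfindOpt h.to_comp).dom_re.of_eq fun a => ?_
  rw [Nat.rfindOpt_dom]
  constructor
  · rintro ⟨n, u, hu⟩
    simp only [Option.mem_def, Option.bind_eq_some_iff] at hu
    obtain ⟨b, -, hb⟩ := hu
    exact ⟨b, by by_contra h; simp [h] at hb⟩
  · rintro ⟨b, hb⟩
    exact ⟨encode b, (), by simp [encodek, hb]⟩

theorem rePred_exists {P : α × β → Prop} (hP : REPred P) : REPred fun a => ∃ b, P (a, b) := by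
  obtain ⟨T, hT, -, h⟩ := exists_stages hP
  have : PrimrecRel fun (a : α) (x : ℕ × β) => T x.1 (a, x.2) :=
    hT.comp (Primrec.fst.comp Primrec.snd)
      (Primrec.fst.pair (Primrec.snd.comp Primrec.snd))
  refine (rePred_exists_of_primrecRel this).of_eq fun a => ?_
  simp only [h, Prod.exists]
  exact exists_comm

/-- The stages are increasing, so one stage confirms all the members of a finite list. -/
theorem rePred_forall_mem_list {P : β × α → Prop} (hP : REPred P) :
    REPred fun x : List β × α => ∀ b ∈ x.1, P (b, x.2) := by
  obtain ⟨T, hT, hmono, h⟩ := exists_stages hP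
  have h₁ : PrimrecRel fun (b : β) (y : ℕ × α) => T y.1 (b, y.2) :=
    hT.comp (Primrec.fst.comp Primrec.snd) (Primrec.fst.pair (Primrec.snd.comp Primrec.snd))
  have h₂ : PrimrecRel fun (x : List β × α) (k : ℕ) => ∀ b ∈ x.1, T k (b, x.2) :=
    h₁.forall_mem_list.comp (Primrec.fst.comp Primrec.fst)
      (Primrec.snd.pair (Primrec.snd.comp Primrec.fst))
  refine (rePred_exists_of_primrecRel h₂).of_eq fun ⟨l, a⟩ => ?_
  simp only [h]
  constructor
  · rintro ⟨k, hk⟩ b hb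
    exact ⟨k, hk b hb⟩
  · intro H
    induction l with
    | nil => exact ⟨0, by simp⟩
    | cons b l ih =>
      obtain ⟨k, hk⟩ := ih fun b hb => H b (List.mem_cons_of_mem _ hb)
      obtain ⟨m, hm⟩ := H b List.mem_cons_self
      refine ⟨max k m, fun b' hb' => ?_⟩
      rcases List.mem_cons.1 hb' with rfl | hb'
      · exact hmono _ _ _ (le_max_right _ _) hm
      · exact hmono _ _ _ (le_max_left _ _) (hk b' hb')

end REPred

/-! ### The semimeasure as the probability of a set of coin tosses -/

section Coin

open MeasureTheory

/-- The uniform measure on infinite binary sequences: independent tosses of a fair coin. -/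
noncomputable def coin : Measure (ℕ → Bool) :=
  Measure.infinitePi fun _ => (PMF.uniformOfFintype Bool).toMeasure

instance : IsProbabilityMeasure coin := by
  unfold coin
  infer_instance

/-- The set of the infinite sequences that extend the string `p`. -/
def extensions (p : Str) : Set (ℕ → Bool) :=
  {ω | initial ω p.length = p}

@[simp]
theorem length_initial (ω : ℕ → Bool) (n : ℕ) : (initial ω n).length = n := by
  simp [initial]

theorem initial_isPrefix (ω : ℕ → Bool) {m n : ℕ} (h : m ≤ n) :
    initial ω m <+: initial ω n := by
  obtain ⟨k, rfl⟩ := Nat.exists_eq_add_of_le h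
  simp [initial, List.range_add]

theorem initial_eq_of_isPrefix {ω : ℕ → Bool} {p : Str} {n : ℕ} (h : p <+: initial ω n) :
    initial ω p.length = p := by
  have hn : p.length ≤ n := by simpa using h.length_le
  exact ((List.prefix_of_prefix_length_le h (initial_isPrefix ω hn) (by simp)).eq_of_length
    (by simp)).symm

theorem initial_eq_iff {ω : ℕ → Bool} {p : Str} :
    initial ω p.length = p ↔ ∀ n, (h : n < p.length) → ω n = p[n] := by
  constructor
  · intro h n hn
    have : (initial ω p.length)[n]'(by simpa) = p[n] := by simp [h]
    simpa [initial] using this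
  · intro h
    refine List.ext_getElem (by simp) fun n h₁ h₂ => ?_
    simpa [initial] using h n h₂

theorem extensions_eq_pi (p : Str) :
    extensions p = Set.pi (Finset.range p.length) fun n => {p.getD n false} := by
  ext ω
  simp only [extensions, Set.mem_ofPred_eq, initial_eq_iff, Set.mem_pi, Finset.coe_range,
    Set.mem_Iio, Set.mem_singleton_iff]
  refine forall_congr' fun n => forall_congr' fun h => ?_
  simp [h]

theorem measurableSet_extensions (p : Str) : MeasurableSet (extensions p) := by
  rw [extensions_eq_pi]
  exact MeasurableSet.pi (Finset.countable_toSet _) fun _ _ => MeasurableSet.of_discrete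

theorem coin_extensions (p : Str) : coin (extensions p) = 2⁻¹ ^ p.length := by
  rw [extensions_eq_pi, coin, Measure.infinitePi_pi _ fun _ _ => MeasurableSet.of_discrete]
  simp

theorem disjoint_extensions {p q : Str} (hpq : ¬ p <+: q) (hqp : ¬ q <+: p) :
    Disjoint (extensions p) (extensions q) := by
  refine Set.disjoint_left.2 fun ω hp hq => ?_
  rw [extensions, Set.mem_ofPred_eq] at hp hq
  rcases le_total p.length q.length with h | h
  · exact hpq (hp ▸ hq ▸ initial_isPrefix ω (by simpa using h))
  · exact hqp (hp ▸ hq ▸ initial_isPrefix ω (by simpa using h))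

/-- The set of the coin tosses from which the machine `L` produces an extension of `y`. -/
def producing (L : Set (Str × Str)) (y : Str) : Set (ℕ → Bool) :=
  {ω | ∃ n z, (initial ω n, z) ∈ L ∧ y <+: z}

theorem extensions_subset_producing {L : Set (Str × Str)} {p q y z : Str} (hp : (p, z) ∈ L)
    (hpq : p <+: q) (hy : y <+: z) : extensions q ⊆ producing L y := by
  intro ω hω
  have hω : initial ω q.length = q := hω
  exact ⟨p.length, z, by rwa [initial_eq_of_isPrefix (hω.symm ▸ hpq)], hy⟩

theorem producing_eq_iUnion (L : Set (Str × Str)) (y : Str) :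
    producing L y = ⋃ p : {p : Str // Outputs L p y}, extensions p.1 := by
  classical
  ext ω
  constructor
  · intro h
    have hex : ∃ n, ∃ z, (initial ω n, z) ∈ L ∧ y <+: z := h
    refine Set.mem_iUnion.2 ⟨⟨initial ω (Nat.find hex), Nat.find_spec hex, ?_⟩, ?_⟩
    · rintro ⟨q, z, hq, ⟨hqp, hne⟩, hz⟩
      have hlt : q.length < Nat.find hex := by
        refine lt_of_le_of_ne (by simpa using hqp.length_le) fun h => hne ?_
        exact hqp.eq_of_length (by simpa using h)
      exact Nat.find_min hex hlt ⟨z, by rwa [initial_eq_of_isPrefix hqp], hz⟩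
    · simp [extensions]
  · intro h
    obtain ⟨⟨p, ⟨z, hp, hz⟩, _⟩, hω⟩ := Set.mem_iUnion.1 h
    exact extensions_subset_producing hp (List.prefix_refl p) hz hω

theorem measurableSet_producing (L : Set (Str × Str)) (y : Str) :
    MeasurableSet (producing L y) := by
  rw [producing_eq_iUnion]
  exact MeasurableSet.iUnion fun p => measurableSet_extensions p.1

/-- The minimal programs that produce `y` are pairwise incomparable, so the sum that defines
the semimeasure is the probability that coin tosses make the machine produce `y`. -/
theorem semimeasure_eq_coin (L : Set (Str × Str)) (y : Str) :
    semimeasure L y = coin (producing L y) := by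
  rw [producing_eq_iUnion, measure_iUnion (f := fun p : {p // Outputs L p y} => extensions p.1) ?_
    fun p => measurableSet_extensions p.1]
  · simp [semimeasure, coin_extensions]
  · rintro ⟨p, hp, hp'⟩ ⟨q, hq, hq'⟩ hne
    have hpq : p ≠ q := fun h => hne (Subtype.ext h)
    obtain ⟨u, hu, hyu⟩ := hp
    obtain ⟨v, hv, hyv⟩ := hq
    exact disjoint_extensions (fun h => hq' ⟨p, u, hu, ⟨h, hpq⟩, hyu⟩)
      fun h => hp' ⟨q, v, hv, ⟨h, hpq.symm⟩, hyv⟩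

theorem semimeasure_le_one (L : Set (Str × Str)) (y : Str) : semimeasure L y ≤ 1 := by
  rw [semimeasure_eq_coin]
  exact prob_le_one

theorem le_semimeasure {L : Set (Str × Str)} {p y : Str} (h : (p, y) ∈ L) :
    2⁻¹ ^ p.length ≤ semimeasure L y := by
  rw [semimeasure_eq_coin, ← coin_extensions]
  exact measure_mono (extensions_subset_producing h (List.prefix_refl p) (List.prefix_refl y))

/-- The semimeasure is approximated from below by counting, for large `N`, the strings of
length `N` that have a program for `y` among their prefixes. -/
theorem lt_semimeasure_iff (L : Set (Str × Str)) (y : Str) (δ : ℝ≥0∞) :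
    δ < semimeasure L y ↔ ∃ (N : ℕ) (l : List Str), l.Nodup ∧
      (∀ q ∈ l, q.length = N ∧ ∃ p z, (p, z) ∈ L ∧ p <+: q ∧ y <+: z) ∧
      δ < l.length * 2⁻¹ ^ N := by
  classical
  rw [semimeasure_eq_coin]
  constructor
  · intro h
    let A : ℕ → Set (ℕ → Bool) := fun N => {ω | ∃ n ≤ N, ∃ z, (initial ω n, z) ∈ L ∧ y <+: z}
    have hA : producing L y = ⋃ N, A N := by
      ext ω
      simp only [producing, A, Set.mem_ofPred_eq, Set.mem_iUnion]
      exact ⟨fun ⟨n, h⟩ => ⟨n, n, le_rfl, h⟩, fun ⟨_, n, _, h⟩ => ⟨n, h⟩⟩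
    have hmono : Monotone A := fun M N hMN ω ⟨n, hn, h⟩ => ⟨n, hn.trans hMN, h⟩
    rw [hA, hmono.measure_iUnion, lt_iSup_iff] at h
    obtain ⟨N, hN⟩ := h
    have hfin : {q : Str | q.length = N ∧ ∃ p z, (p, z) ∈ L ∧ p <+: q ∧ y <+: z}.Finite :=
      (List.finite_length_eq Bool N).subset fun q hq => hq.1
    refine ⟨N, hfin.toFinset.toList, Finset.nodup_toList _, by simp, hN.trans_le ?_⟩
    have hsub : A N ⊆ ⋃ q ∈ hfin.toFinset, extensions q := by
      rintro ω ⟨n, hn, z, hz, hyz⟩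
      refine Set.mem_biUnion (x := initial ω N) ?_ (by simp [extensions])
      simpa using ⟨_, z, hz, initial_isPrefix ω hn, hyz⟩
    calc coin (A N) ≤ coin (⋃ q ∈ hfin.toFinset, extensions q) := measure_mono hsub
      _ ≤ ∑ q ∈ hfin.toFinset, coin (extensions q) := measure_biUnion_finset_le _ _
      _ = ∑ q ∈ hfin.toFinset, 2⁻¹ ^ N := Finset.sum_congr rfl fun q hq => by
        rw [coin_extensions, ((Set.Finite.mem_toFinset _).1 hq).1]
      _ = _ := by simp
  · rintro ⟨N, l, hl, hq, hδ⟩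
    refine hδ.trans_le ?_
    calc (l.length : ℝ≥0∞) * 2⁻¹ ^ N = ∑ q ∈ l.toFinset, coin (extensions q) := by
          rw [Finset.sum_congr rfl fun q h => by
            rw [coin_extensions, (hq q (List.mem_toFinset.1 h)).1]]
          simp [List.toFinset_card_of_nodup hl]
      _ = coin (⋃ q ∈ l.toFinset, extensions q) := by
          refine (measure_biUnion_finset (fun p hp q hq' hne => ?_)
            fun q _ => measurableSet_extensions q).symm
          have hp := (hq p (by simpa using hp)).1
          have hq' := (hq q (by simpa using hq')).1
          exact disjoint_extensions (fun h => hne (h.eq_of_length (hp.trans hq'.symm)))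
            fun h => hne (h.eq_of_length (hq'.trans hp.symm)).symm
      _ ≤ coin (producing L y) := by
          refine measure_mono (Set.iUnion₂_subset fun q h => ?_)
          obtain ⟨-, p, z, hp, hpq, hyz⟩ := hq q (List.mem_toFinset.1 h)
          exact extensions_subset_producing hp hpq hyz

theorem disjoint_producing {L : Set (Str × Str)} (hL : IsMonotoneMachine L) {x y : Str}
    (hxy : ¬ x <+: y) (hyx : ¬ y <+: x) : Disjoint (producing L x) (producing L y) := by
  refine Set.disjoint_left.2 ?_
  rintro ω ⟨m, u, hu, hxu⟩ ⟨n, v, hv, hyv⟩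
  have huv : u <+: v ∨ v <+: u := by
    rcases le_total m n with h | h
    · exact hL.2 _ _ _ _ hu hv (initial_isPrefix ω h)
    · exact (hL.2 _ _ _ _ hv hu (initial_isPrefix ω h)).symm
  obtain ⟨w, hxw, hyw⟩ : ∃ w, x <+: w ∧ y <+: w := by
    rcases huv with h | h
    · exact ⟨v, hxu.trans h, hyv⟩
    · exact ⟨u, hxu, hyv.trans h⟩
  exact (List.prefix_or_prefix_of_prefix hxw hyw).elim hxy hyx

end Coin

/-! ### Lower semicomputability -/

theorem rePred_isPrefix {α : Type*} [Primcodable α] {f g : α → Str} (hf : Computable f)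
    (hg : Computable g) : REPred fun a => f a <+: g a :=
  rePred_exists (P := fun a : α × Str => f a.1 ++ a.2 = g a.1) <|
    rePred_eq (Computable.list_append.comp (hf.comp Computable.fst) Computable.snd)
      (hg.comp Computable.fst)

theorem primrecPred_nodup {α : Type*} [Primcodable α] : PrimrecPred (List.Nodup (α := α)) := by
  classical
  have h₁ : PrimrecRel fun (i : ℕ) (x : List α × ℕ) => x.1[i]? ≠ x.1[x.2]? :=
    PrimrecPred.not <| Primrec.eq.comp
      (Primrec.list_getElem?.comp (Primrec.fst.comp Primrec.snd) Primrec.fst)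
      (Primrec.list_getElem?.comp (Primrec.fst.comp Primrec.snd)
        (Primrec.snd.comp Primrec.snd))
  have h₂ : PrimrecRel fun (j : ℕ) (l : List α) => ∀ i ∈ List.range j, l[i]? ≠ l[j]? :=
    h₁.forall_mem_list.comp (Primrec.list_range.comp Primrec.fst) (Primrec.snd.pair Primrec.fst)
  refine (h₂.forall_mem_list.comp (Primrec.list_range.comp Primrec.list_length)
    Primrec.id).of_eq fun l => ?_
  simp only [List.nodup_iff_getElem?_ne_getElem?, List.mem_range]
  exact ⟨fun h i j hij hj => h j hj i hij, fun h j hj i hij => h i j hij hj⟩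

theorem inv_four_pow_lt_iff (j k N : ℕ) :
    (4⁻¹ : ℝ≥0∞) ^ j < k * 2⁻¹ ^ N ↔ 2 ^ N < k * 4 ^ j := by
  have h₁ : (4⁻¹ : ℝ≥0∞) ^ j ≠ ∞ := by simp
  have h₂ : (k : ℝ≥0∞) * 2⁻¹ ^ N ≠ ∞ := ENNReal.mul_ne_top (by simp) (by simp)
  rw [← ENNReal.toReal_lt_toReal h₁ h₂, ← Nat.cast_lt (α := ℝ)]
  simp only [ENNReal.toReal_pow, ENNReal.toReal_inv, ENNReal.toReal_mul, ENNReal.toReal_natCast,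
    ENNReal.toReal_ofNat, inv_pow, Nat.cast_mul, Nat.cast_pow, Nat.cast_ofNat]
  rw [← div_eq_mul_inv, inv_lt_iff_one_lt_mul₀ (by positivity), div_mul_eq_mul_div,
    one_lt_div (by positivity)]

/-- The semimeasure of a machine is lower semicomputable: a large enough finite set of strings
with a program among their prefixes is a finite certificate for the inequality. -/
theorem rePred_inv_four_pow_lt_semimeasure {U : Set (Str × Str)} (hU : IsMachine U) :
    REPred fun a : Str × ℕ => (4⁻¹ : ℝ≥0∞) ^ a.2 < semimeasure U a.1 := by
  classical
  have hpow : Primrec₂ ((· ^ ·) : ℕ → ℕ → ℕ) := Primrec₂.unpaired'.1 Nat.Primrec.pow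
  have hgood : REPred fun a : Str × Str => ∃ b : Str × Str, b ∈ U ∧ b.1 <+: a.1 ∧ a.2 <+: b.2 :=
    rePred_exists (P := fun x : (Str × Str) × (Str × Str) =>
        x.2 ∈ U ∧ x.2.1 <+: x.1.1 ∧ x.1.2 <+: x.2.2) <|
      rePred_and (rePred_comp hU Computable.snd) <| rePred_and
        (rePred_isPrefix (Computable.fst.comp Computable.snd)
          (Computable.fst.comp Computable.fst))
        (rePred_isPrefix (Computable.snd.comp Computable.fst)
          (Computable.snd.comp Computable.snd))
  have hlen : REPred fun a : Str × ℕ => a.1.length = a.2 :=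
    rePred_eq (Computable.list_length.comp Computable.fst) Computable.snd
  have hcount : PrimrecPred fun x : (Str × ℕ) × (ℕ × List Str) =>
      2 ^ x.2.1 < x.2.2.length * 4 ^ x.1.2 :=
    Primrec.nat_lt.comp
      (hpow.comp (Primrec.const 2) (Primrec.fst.comp Primrec.snd))
      (Primrec.nat_mul.comp (Primrec.list_length.comp (Primrec.snd.comp Primrec.snd))
        (hpow.comp (Primrec.const 4) (Primrec.snd.comp Primrec.fst)))
  have hnodup : PrimrecPred fun x : (Str × ℕ) × (ℕ × List Str) => x.2.2.Nodup :=
    primrecPred_nodup.comp (Primrec.snd.comp Primrec.snd)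
  have hprim : ∀ {P : (Str × ℕ) × (ℕ × List Str) → Prop}, PrimrecPred P → REPred P :=
    fun ⟨_, h⟩ => ComputablePred.to_re (ComputablePred.computable_iff.2 ⟨_, h.to_comp, by simp⟩)
  have hall : REPred fun x : (Str × ℕ) × (ℕ × List Str) => ∀ q ∈ x.2.2, q.length = x.2.1 ∧
      ∃ b : Str × Str, b ∈ U ∧ b.1 <+: q ∧ x.1.1 <+: b.2 :=
    rePred_comp (rePred_forall_mem_list (P := fun y : Str × (ℕ × Str) => y.1.length = y.2.1 ∧
        ∃ b : Str × Str, b ∈ U ∧ b.1 <+: y.1 ∧ y.2.2 <+: b.2) <|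
      rePred_and
        (rePred_comp hlen (Computable.fst.pair (Computable.fst.comp Computable.snd)))
        (rePred_comp hgood (Computable.fst.pair (Computable.snd.comp Computable.snd))))
      (f := fun x : (Str × ℕ) × (ℕ × List Str) => (x.2.2, (x.2.1, x.1.1))) <|
      (Computable.snd.comp Computable.snd).pair <|
        (Computable.fst.comp Computable.snd).pair (Computable.fst.comp Computable.fst)
  refine (rePred_exists (rePred_and (hprim hnodup) (rePred_and hall (hprim hcount)))).of_eq
    fun ⟨y, j⟩ => ?_
  simp only [lt_semimeasure_iff, inv_four_pow_lt_iff, Prod.exists]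

/-! ### Universal monotone machines -/

/-- Comparable programs of a universal machine carry the same code word, hence address the same
monotone machine. -/
theorem isMonotoneMachine_of_isUniversal {U : Set (Str × Str)}
    (hU : IsUniversalMonotoneMachine U) : IsMonotoneMachine U := by
  obtain ⟨L, c, ⟨hL, hmono, -⟩, ⟨hc, hpre⟩, rfl⟩ := hU
  constructor
  · have h₁ : REPred fun x : (Str × Str) × (ℕ × Str) => c x.2.1 ++ x.2.2 = x.1.1 :=
      rePred_eq (Computable.list_append.comp
        (hc.comp (Computable.fst.comp Computable.snd)) (Computable.snd.comp Computable.snd))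
        (Computable.fst.comp Computable.fst)
    have h₂ : REPred fun x : (Str × Str) × (ℕ × Str) => (x.2.2, x.1.2) ∈ L x.2.1 :=
      rePred_comp hL (f := fun x : (Str × Str) × (ℕ × Str) => (x.2.1, (x.2.2, x.1.2))) <|
        (Computable.fst.comp Computable.snd).pair <|
          (Computable.snd.comp Computable.snd).pair (Computable.snd.comp Computable.fst)
    refine (rePred_exists (rePred_and h₁ h₂)).of_eq fun ⟨r, y⟩ => ?_
    constructor
    · rintro ⟨⟨i, p⟩, h, hp⟩
      exact ⟨i, p, y, Prod.ext h.symm rfl, hp⟩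
    · rintro ⟨i, p, y', h, hp⟩
      obtain ⟨rfl, rfl⟩ := Prod.mk.inj h
      exact ⟨(i, p), rfl, hp⟩
  · rintro _ y _ z ⟨i, p, y', h, hp⟩ ⟨j, q, z', h', hq⟩ hpq
    obtain ⟨rfl, rfl⟩ := Prod.mk.inj h
    obtain ⟨rfl, rfl⟩ := Prod.mk.inj h'
    have hij : i = j := by
      rcases List.prefix_or_prefix_of_prefix ((List.prefix_append (c i) p).trans hpq)
        (List.prefix_append (c j) q) with h | h
      · exact hpre _ _ h
      · exact (hpre _ _ h).symm
    subst hij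
    exact (hmono i).2 _ _ _ _ hp hq ((List.prefix_append_right_inj _).1 hpq)

/-- A universal machine simulates every monotone machine, at the cost of a constant number of
additional program bits. -/
theorem exists_simulation {U : Set (Str × Str)} (hU : IsUniversalMonotoneMachine U)
    {S : Set (Str × Str)} (hS : IsMonotoneMachine S) :
    ∃ d : ℕ, ∀ p y, (p, y) ∈ S → 2⁻¹ ^ (d + p.length) ≤ semimeasure U y := by
  obtain ⟨L, c, ⟨-, -, hall⟩, -, rfl⟩ := hU
  obtain ⟨i, rfl⟩ := hall S hS
  refine ⟨(c i).length, fun p y h => ?_⟩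
  rw [← List.length_append]
  exact le_semimeasure ⟨i, p, y, rfl, h⟩

theorem isMonotoneMachine_singleton (x : Str) : IsMonotoneMachine {([], x)} := by
  refine ⟨(rePred_eq Computable.id (Computable.const ([], x))).of_eq fun a => by simp, ?_⟩
  rintro p y q z hp hq -
  rw [Set.mem_singleton_iff, Prod.mk.injEq] at hp hq
  exact Or.inl (by rw [hp.2, hq.2])

theorem semimeasure_pos {U : Set (Str × Str)} (hU : IsUniversalMonotoneMachine U) (x : Str) :
    0 < semimeasure U x := by
  obtain ⟨d, hd⟩ := exists_simulation hU (isMonotoneMachine_singleton x)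
  exact (ENNReal.pow_pos (by simp) _).trans_le (hd [] x rfl)

/-! ### The evading machine -/

/-- A sequence of strings that grows bit by bit cannot at every step leave a bit behind whose
semimeasure exceeds a fixed positive bound: the strings left behind are pairwise incomparable,
so their semimeasures add up to at most one. -/
theorem exists_not_lt_semimeasure {U : Set (Str × Str)} (hU : IsMonotoneMachine U) {δ : ℝ≥0∞}
    (hδ : δ ≠ 0) (y : ℕ → Str) (b : ℕ → Bool) (hy : ∀ n, y (n + 1) = y n ++ [b n]) :
    ∃ n, ¬ δ < semimeasure U (y n ++ [!b n]) := by
  by_contra! h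
  have hpre : ∀ m n, m ≤ n → y m <+: y n := fun m n hmn => by
    induction n, hmn using Nat.le_induction with
    | base => exact List.prefix_refl _
    | succ n _ ih => exact ih.trans (hy n ▸ List.prefix_append _ _)
  -- The string left behind at step `m` disagrees with every later one in its last bit.
  have hne : ∀ m n, m < n → ∀ w, ¬ (y m ++ [!b m] <+: w ∧ y n <+: w) := by
    rintro m n hmn w ⟨h₁, h₂⟩
    have h₃ : y m ++ [b m] <+: w := (hy m ▸ hpre (m + 1) n hmn).trans h₂
    have := (List.prefix_of_prefix_length_le h₁ h₃ (by simp)).eq_of_length (by simp)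
    simp at this
  have hdis : ∀ m n, m < n → Disjoint (producing U (y m ++ [!b m]))
      (producing U (y n ++ [!b n])) := fun m n hmn =>
    disjoint_producing hU
      (fun h => hne m n hmn _ ⟨h, List.prefix_append _ _⟩)
      (fun h => hne m n hmn _ ⟨List.prefix_refl _, (List.prefix_append _ _).trans h⟩)
  have hsum : coin Set.univ < ∑' n, coin (producing U (y n ++ [!b n])) := by
    have htop : ∑' _ : ℕ, δ = ∞ := ENNReal.tsum_const_eq_top_of_ne_zero hδ
    have : ∑' n, coin (producing U (y n ++ [!b n])) = ∞ := by
      refine top_le_iff.1 (htop ▸ ENNReal.tsum_le_tsum fun n => ?_)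
      rw [← semimeasure_eq_coin]
      exact (h n).le
    rw [this]
    exact MeasureTheory.measure_lt_top _ _
  obtain ⟨m, n, hmn, hinter⟩ :=
    MeasureTheory.exists_nonempty_inter_of_measure_univ_lt_tsum_measure coin
      (fun n => (measurableSet_producing U (y n ++ [!b n])).nullMeasurableSet) hsum
  rw [← Set.not_disjoint_iff_nonempty_inter] at hinter
  rcases lt_or_gt_of_ne hmn with h | h
  · exact hinter (hdis m n h)
  · exact hinter (hdis n m h).symm

/-- A partial recursive strategy that, given a string `y` and a number `j`, waits until the
semimeasure of `y0` or of `y1` exceeds `4⁻ʲ` and then returns the other bit. -/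
theorem exists_evasion {U : Set (Str × Str)} (hU : IsMachine U) :
    ∃ k : Str × ℕ →. Bool, Partrec k ∧
      (∀ y j, ∀ b ∈ k (y, j), (4⁻¹ : ℝ≥0∞) ^ j < semimeasure U (y ++ [!b])) ∧
      ∀ y j, ¬ (k (y, j)).Dom → ∀ b, semimeasure U (y ++ [b]) ≤ 4⁻¹ ^ j := by
  have hre := rePred_inv_four_pow_lt_semimeasure hU
  have hbit : ∀ b, Partrec fun a : Str × ℕ =>
      (Part.assert ((4⁻¹ : ℝ≥0∞) ^ a.2 < semimeasure U (a.1 ++ [b]))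
        fun _ => Part.some ()).map fun _ => !b := fun b =>
    Partrec.map (rePred_comp hre (f := fun a : Str × ℕ => (a.1 ++ [b], a.2))
      ((Computable.list_concat.comp Computable.fst (Computable.const b)).pair Computable.snd))
      (Computable.const (!b)).to₂
  obtain ⟨k, hk, hspec⟩ := Partrec.merge' (hbit false) (hbit true)
  refine ⟨k, hk, fun y j b hb => ?_, fun y j hdom b => ?_⟩
  · rcases (hspec (y, j)).1 b hb with h | h <;>
    · obtain ⟨_, hu, rfl⟩ := (Part.mem_map_iff _).1 h
      simpa using (Part.mem_assert_iff.1 hu).1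
  · rw [(hspec (y, j)).2, not_or] at hdom
    by_contra! h
    cases b
    · exact hdom.1 ⟨h, trivial⟩
    · exact hdom.2 ⟨h, trivial⟩

/-- The string reached from `x` after `n` bits chosen by the strategy `k` with parameter `j`. -/
def evade (k : Str × ℕ →. Bool) (x : Str) (j n : ℕ) : Part Str :=
  n.rec (Part.some x) fun _ IH => IH.bind fun y => (k (y, j)).map fun b => y ++ [b]

theorem partrec_evade {k : Str × ℕ →. Bool} (hk : Partrec k) (x : Str) :
    Partrec fun a : ℕ × ℕ => evade k x a.1 a.2 := by
  have hstep : Partrec₂ fun (a : ℕ × ℕ) (z : ℕ × Str) =>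
      (k (z.2, a.1)).map fun b => z.2 ++ [b] :=
    Partrec.map (hk.comp ((Computable.snd.comp Computable.snd).pair
        (Computable.fst.comp Computable.fst)))
      (Computable.list_concat.comp
        (Computable.snd.comp (Computable.snd.comp Computable.fst)) Computable.snd).to₂
  exact Partrec.nat_rec Computable.snd (Computable.const x) hstep

theorem evade_isPrefix {k : Str × ℕ →. Bool} {x : Str} {j m n : ℕ} (hmn : m ≤ n) {y z : Str}
    (hy : y ∈ evade k x j m) (hz : z ∈ evade k x j n) : y <+: z := by
  induction n, hmn using Nat.le_induction generalizing z with
  | base => exact Part.mem_unique hy hz ▸ List.prefix_refl _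
  | succ n _ ih =>
    obtain ⟨w, hw, hz⟩ := Part.mem_bind_iff.1 hz
    obtain ⟨b, -, rfl⟩ := (Part.mem_map_iff _).1 hz
    exact (ih hw).trans (List.prefix_append _ _)

/-- The self-delimiting program `0ʲ1`. -/
def unary (j : ℕ) : Str :=
  (List.range j).map (fun _ => false) ++ [true]

theorem computable_unary : Computable unary :=
  Primrec.to_comp <| Primrec.list_concat.comp
    (Primrec.list_map Primrec.list_range (Primrec.const false).to₂) (Primrec.const true)

@[simp]
theorem length_unary (j : ℕ) : (unary j).length = j + 1 := by
  simp [unary]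

theorem unary_eq (j : ℕ) : unary j = List.replicate j false ++ [true] := by
  simp [unary]

theorem eq_of_unary_isPrefix {i j : ℕ} (h : unary i <+: unary j) : i = j := by
  rw [unary_eq, unary_eq] at h
  induction i generalizing j with
  | zero => cases j <;> simp_all [List.replicate_succ]
  | succ i ih =>
    cases j with
    | zero => simp [List.replicate_succ] at h
    | succ j => rw [ih (j := j) (by simpa [List.replicate_succ] using h)]

/-- The machine that, on the program `0ʲ1`, follows the strategy `k` with parameter `j`. -/
def evadingMachine (k : Str × ℕ →. Bool) (x : Str) : Set (Str × Str) :=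
  {a | ∃ b : ℕ × ℕ, unary b.1 = a.1 ∧ a.2 ∈ evade k x b.1 b.2}

theorem isMonotoneMachine_evadingMachine {k : Str × ℕ →. Bool} (hk : Partrec k) (x : Str) :
    IsMonotoneMachine (evadingMachine k x) := by
  classical
  constructor
  · have hmem : REPred fun a : (ℕ × ℕ) × Str => a.2 ∈ evade k x a.1.1 a.1.2 := by
      have heq : REPred fun z : ((ℕ × ℕ) × Str) × Str => z.2 = z.1.2 :=
        rePred_eq Computable.snd (Computable.snd.comp Computable.fst)
      refine (Partrec.bind ((partrec_evade hk x).comp Computable.fst) heq.to₂).dom_re.of_eq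
        fun a => ?_
      rw [Part.dom_iff_mem]
      constructor
      · rintro ⟨_, h⟩
        obtain ⟨z, hz, hz'⟩ := Part.mem_bind_iff.1 h
        obtain ⟨hza, -⟩ := Part.mem_assert_iff.1 hz'
        have hza : z = a.2 := hza
        exact hza ▸ hz
      · intro h
        exact ⟨(), Part.mem_bind_iff.2 ⟨_, h, Part.mem_assert_iff.2 ⟨rfl, Part.mem_some _⟩⟩⟩
    refine rePred_exists (P := fun z : (Str × Str) × (ℕ × ℕ) =>
      unary z.2.1 = z.1.1 ∧ z.1.2 ∈ evade k x z.2.1 z.2.2) (rePred_and ?_ ?_)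
    · exact rePred_eq (computable_unary.comp (Computable.fst.comp Computable.snd))
        (Computable.fst.comp Computable.fst)
    · exact rePred_comp hmem (f := fun z : (Str × Str) × (ℕ × ℕ) => (z.2, z.1.2))
        (Computable.snd.pair (Computable.snd.comp Computable.fst))
  · rintro _ y _ z ⟨⟨i, m⟩, rfl, hy⟩ ⟨⟨j, n⟩, rfl, hz⟩ hpq
    obtain rfl := eq_of_unary_isPrefix hpq
    rcases le_total m n with h | h
    · exact Or.inl (evade_isPrefix h hy hz)
    · exact Or.inr (evade_isPrefix h hz hy)

/-- On every program `0ʲ1` the evading strategy reaches a string from which it never moves on. -/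
theorem exists_evade_stuck {U : Set (Str × Str)} (hU : IsMonotoneMachine U)
    {k : Str × ℕ →. Bool}
    (hk : ∀ y j, ∀ b ∈ k (y, j), (4⁻¹ : ℝ≥0∞) ^ j < semimeasure U (y ++ [!b]))
    (x : Str) (j : ℕ) : ∃ n, ∃ y ∈ evade k x j n, ¬ (k (y, j)).Dom := by
  by_contra! h
  have hdom : ∀ n, (evade k x j n).Dom := fun n => by
    induction n with
    | zero => trivial
    | succ n ih => exact ⟨ih, h n _ (Part.get_mem ih)⟩
  have hk' : ∀ n, (k ((evade k x j n).get (hdom n), j)).Dom :=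
    fun n => h n _ (Part.get_mem (hdom n))
  obtain ⟨n, hn⟩ := exists_not_lt_semimeasure hU (δ := 4⁻¹ ^ j) (by simp)
    (fun n => (evade k x j n).get (hdom n)) (fun n => (k _).get (hk' n)) fun n => rfl
  exact hn (hk _ _ _ (Part.get_mem (hk' n)))

/-! ### Strings that lose almost all of their semimeasure -/

/-- Every string has an extension at which almost all of the semimeasure is lost. The machine
that evades the universal one gets stuck on the program `0ʲ1` at a string `y` with
`M(y0) + M(y1) ≤ 2 · 4⁻ʲ`, while its program makes `M(y)` at least a constant times `2⁻ʲ`. -/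
theorem exists_extension_cond_le {U : Set (Str × Str)} (hU : IsUniversalMonotoneMachine U)
    (x : Str) {ε : ℝ≥0∞} (hε : ε ≠ 0) :
    ∃ y, x <+: y ∧ cond U false y + cond U true y ≤ ε := by
  have hU' := isMonotoneMachine_of_isUniversal hU
  obtain ⟨k, hk, hlt, hle⟩ := exists_evasion hU'.1
  obtain ⟨d, hd⟩ := exists_simulation hU (isMonotoneMachine_evadingMachine hk x)
  obtain ⟨j, hj⟩ := ENNReal.exists_inv_two_pow_lt (a := ε * 2⁻¹ ^ (d + 2))
    (mul_ne_zero hε (by simp))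
  obtain ⟨n, y, hy, hstuck⟩ := exists_evade_stuck hU' hlt x j
  have hxy : x <+: y := evade_isPrefix (Nat.zero_le n) (Part.mem_some x) hy
  have hM : 2⁻¹ ^ (d + (j + 1)) ≤ semimeasure U y := by
    simpa using hd (unary j) y ⟨(j, n), rfl, hy⟩
  have h₄ : (4⁻¹ : ℝ≥0∞) = 2⁻¹ * 2⁻¹ := by
    rw [← ENNReal.mul_inv (by simp) (by simp)]
    norm_num
  have h₂ : (2 : ℝ≥0∞) * 2⁻¹ = 1 := ENNReal.mul_inv_cancel (by simp) (by simp)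
  refine ⟨y, hxy, ?_⟩
  rw [cond, cond, ← ENNReal.add_div]
  refine ENNReal.div_le_of_le_mul ?_
  calc semimeasure U (y ++ [false]) + semimeasure U (y ++ [true])
      ≤ 4⁻¹ ^ j + 4⁻¹ ^ j := add_le_add (hle y j hstuck false) (hle y j hstuck true)
    _ = 2 * 2⁻¹ ^ j * 2⁻¹ ^ j := by rw [h₄, mul_pow]; ring
    _ ≤ 2 * 2⁻¹ ^ j * (ε * 2⁻¹ ^ (d + 2)) := by gcongr
    _ = (2 * 2⁻¹) * (ε * 2⁻¹ ^ (d + (j + 1))) := by ring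
    _ ≤ ε * semimeasure U y := by rw [h₂, one_mul]; gcongr

/-- A chain of proper extensions is the chain of some initial segments of one infinite
sequence. -/
theorem exists_initial_eq {s : ℕ → Str} (hs : ∀ n, ∃ b, s n ++ [b] <+: s (n + 1)) :
    ∃ ω : ℕ → Bool, ∀ n, initial ω (s n).length = s n ∧ n ≤ (s n).length := by
  have hpre : ∀ m n, m ≤ n → s m <+: s n := fun m n hmn => by
    induction n, hmn using Nat.le_induction with
    | base => exact List.prefix_refl _
    | succ n _ ih =>
      obtain ⟨b, hb⟩ := hs n
      exact ih.trans ((List.prefix_append _ _).trans hb)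
  have hlen : ∀ n, n ≤ (s n).length := fun n => by
    induction n with
    | zero => exact Nat.zero_le _
    | succ n ih =>
      obtain ⟨b, hb⟩ := hs n
      have := hb.length_le
      simp only [List.length_append, List.length_singleton] at this
      omega
  refine ⟨fun i => (s (i + 1))[i]'(hlen (i + 1)), fun n => ⟨?_, hlen n⟩⟩
  rw [initial_eq_iff]
  intro i hi
  rcases le_total (i + 1) n with h | h
  · exact (hpre _ _ h).getElem _
  · exact ((hpre _ _ h).getElem hi).symm

end AIT

theorem mainTheorem4 (U : Set (AIT.Str × AIT.Str)) (hU : AIT.IsUniversalMonotoneMachine U) :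
    ∃ ω : ℕ → Bool,
      (∀ n, 0 < AIT.semimeasure U (AIT.initial ω n) ∧ AIT.semimeasure U (AIT.initial ω n) ≤ 1) ∧
      Filter.liminf
        (fun n : ℕ => AIT.cond U false (AIT.initial ω n) + AIT.cond U true (AIT.initial ω n))
        Filter.atTop = 0 := by
  have hstep : ∀ (x : AIT.Str) (n : ℕ), ∃ y, x ++ [false] <+: y ∧
      AIT.cond U false y + AIT.cond U true y ≤ ((n : ℝ≥0∞) + 1)⁻¹ := fun x n =>
    AIT.exists_extension_cond_le hU _ (by simp)
  choose f hf hf' using hstep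
  obtain ⟨s, hs⟩ : ∃ s : ℕ → AIT.Str, ∀ n, s (n + 1) = f (s n) n :=
    ⟨fun n => n.rec [] fun m x => f x m, fun _ => rfl⟩
  obtain ⟨ω, hω⟩ := AIT.exists_initial_eq (s := s) fun n => ⟨false, hs n ▸ hf (s n) n⟩
  refine ⟨ω, fun n => ⟨AIT.semimeasure_pos hU _, AIT.semimeasure_le_one U _⟩, ?_⟩
  refine le_antisymm (ENNReal.le_of_forall_pos_le_add fun ε hε _ => ?_) zero_le
  rw [zero_add]
  refine Filter.liminf_le_of_frequently_le' (Filter.frequently_atTop.2 fun N => ?_)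
  obtain ⟨m, hm⟩ := ENNReal.exists_inv_nat_lt (a := ε) (by simpa using hε.ne')
  refine ⟨(s (max N m + 1)).length, ?_, ?_⟩
  · exact (le_max_left N m).trans ((Nat.le_succ _).trans (hω _).2)
  · rw [(hω _).1, hs]
    refine (hf' (s (max N m)) (max N m)).trans (le_trans ?_ hm.le)
    refine ENNReal.inv_le_inv.2 (le_trans ?_ le_self_add)
    exact_mod_cast le_max_right N m
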